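/- Let $K$ be a field, let $R=K[x,y,z]$ be the polynomial ring in three variables over $K$, let $c$ be a positive integer, and let $I=(x^{2c+2},\,xy^{2c}z,\,y^{2c+2}z)\subset R$. For an ideal $J\subset R$ write $\operatorname{Ass}(J)$ for the set of associated prime ideals of the $R$-module $R/J$, and $\overline{J}$ for the integral closure of $J$, i.e. the ideal of all $r\in R$ satisfying an equation $r^n+a_1r^{n-1}+\cdots+a_n=0$ with $n\ge 1$ and $a_j\in J^j$ for $j=1,\dots,n$. Let $\operatorname{astab}(I)$ be the smallest integer $k_0\ge 1$ such that $\operatorname{Ass}(I^k)=\operatorname{Ass}(I^{k_0})$ for all $k\ge k_0$, and let $\overline{\operatorname{astab}}(I)$ be the smallest integer $k_0\ge 1$ such that $\operatorname{Ass}(\overline{I^k})=\operatorname{Ass}(\overline{I^{k_0}})$ for all $k\ge k_0$. Then $$\operatorname{astab}(I)=c+2\quad\text{and}\quad \overline{\operatorname{astab}}(I)=2 .$$ In particular $\operatorname{astab}(I)-\overline{\operatorname{astab}}(I)=c$, so for every positive integer $c$ there is a monomial ideal in $K[x,y,z]$ for which the two indices differ by exactly $c$. -/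

import Mathlib

namespace AssStability

open Polynomial

/-- `r` is integral over the ideal `I`: it satisfies an equation
`r ^ n + a₁ r ^ (n - 1) + ⋯ + aₙ = 0` with `aⱼ ∈ I ^ j` for `j = 1, …, n`
(here `aⱼ` is the coefficient of index `n - j` of a monic polynomial `p` of degree `n`). -/
def IsIntegralOverIdeal {R : Type*} [CommRing R] (I : Ideal R) (r : R) : Prop :=
  ∃ p : R[X], p.Monic ∧ p.eval r = 0 ∧ ∀ i, p.coeff i ∈ I ^ (p.natDegree - i)

theorem isIntegralOverIdeal_iff {R : Type*} [CommRing R] (I : Ideal R) (r : R) :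
    IsIntegralOverIdeal I r ↔ IsIntegral (reesAlgebra I) (monomial 1 r : R[X]) := by
  constructor
  · rintro ⟨p, hp, h0, hc⟩
    let f : ℕ → reesAlgebra I := fun i =>
      ⟨monomial (p.natDegree - i) (p.coeff i), reesAlgebra.monomial_mem.mpr (hc i)⟩
    refine ⟨X ^ p.natDegree + ∑ i ∈ Finset.range p.natDegree, C (f i) * X ^ i, ?_, ?_⟩
    · refine monic_X_pow_add ((degree_sum_le _ _).trans_lt ?_)
      refine (Finset.sup_lt_iff (WithBot.bot_lt_coe _)).mpr fun i hi => ?_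
      exact (degree_C_mul_X_pow_le _ _).trans_lt
        (WithBot.coe_lt_coe.mpr (Finset.mem_range.mp hi))
    · have key : ∀ i ∈ Finset.range p.natDegree,
          algebraMap (reesAlgebra I) R[X] (f i) * (monomial 1 r : R[X]) ^ i =
            monomial p.natDegree (p.coeff i * r ^ i) := by
        intro i hi
        have hi' := Finset.mem_range.mp hi
        change monomial (p.natDegree - i) (p.coeff i) * (monomial 1 r : R[X]) ^ i = _
        rw [monomial_pow, monomial_mul_monomial]
        congr 2
        omega
      simp only [eval₂_add, eval₂_finsetSum, eval₂_mul, eval₂_C, eval₂_X_pow]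
      rw [Finset.sum_congr rfl key, monomial_pow, one_mul, ← map_sum, ← map_add]
      rw [eval_eq_sum_range, Finset.sum_range_succ, hp.coeff_natDegree, one_mul, add_comm] at h0
      rw [h0, map_zero]
  · rintro ⟨q, hq, h0⟩
    rcases subsingleton_or_nontrivial R with hR | hR
    · refine ⟨1, monic_one, Subsingleton.elim _ _, fun i => ?_⟩
      rw [Subsingleton.elim ((1 : R[X]).coeff i) 0]
      exact zero_mem _
    set n := q.natDegree with hn
    let p : R[X] := X ^ n + ∑ i ∈ Finset.range n, C ((q.coeff i : R[X]).coeff (n - i)) * X ^ i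
    have hdeg : (∑ i ∈ Finset.range n,
        C ((q.coeff i : R[X]).coeff (n - i)) * X ^ i : R[X]).degree < n := by
      refine (degree_sum_le _ _).trans_lt ?_
      refine (Finset.sup_lt_iff (WithBot.bot_lt_coe _)).mpr fun i hi => ?_
      exact (degree_C_mul_X_pow_le _ _).trans_lt
        (WithBot.coe_lt_coe.mpr (Finset.mem_range.mp hi))
    have hpn : p.natDegree = n := by
      refine natDegree_eq_of_degree_eq_some ?_
      rw [degree_add_eq_left_of_degree_lt] <;> rw [degree_X_pow]
      exact hdeg
    refine ⟨p, monic_X_pow_add hdeg, ?_, ?_⟩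
    · have h1 := congrArg (fun g : R[X] => g.coeff n) h0
      rw [eval₂_eq_sum_range] at h1
      simp only [finsetSum_coeff, coeff_zero] at h1
      rw [← hn, Finset.sum_range_succ, hn, hq.coeff_natDegree, ← hn, map_one, one_mul,
        monomial_pow, one_mul, coeff_monomial_same, add_comm] at h1
      rw [← h1]
      simp only [p, eval_add, eval_finsetSum, eval_mul, eval_C, eval_pow, eval_X]
      congr 1
      refine Finset.sum_congr rfl fun i hi => ?_
      have hi' := Finset.mem_range.mp hi
      rw [monomial_pow, one_mul]
      conv_rhs => rw [show n = (n - i) + i by omega]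
      rw [coeff_mul_monomial]
      rfl
    · intro i
      rw [hpn]
      rcases lt_or_ge i n with hi | hi
      · have : p.coeff i = (q.coeff i : R[X]).coeff (n - i) := by
          simp only [p, coeff_add, coeff_X_pow, finsetSum_coeff, coeff_C_mul]
          rw [if_neg hi.ne, zero_add, Finset.sum_eq_single i]
          · simp
          · intro j _ hj
            rw [if_neg hj.symm, mul_zero]
          · intro h
            exact absurd (Finset.mem_range.mpr hi) h
        rw [this]
        exact (q.coeff i).2 (n - i)
      · rw [Nat.sub_eq_zero_of_le hi, pow_zero, Ideal.one_eq_top]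
        trivial

/-- The integral closure of an ideal `I`: the ideal of all elements integral over `I`. -/
def idealIntegralClosure {R : Type*} [CommRing R] (I : Ideal R) : Ideal R where
  carrier := {r | IsIntegralOverIdeal I r}
  add_mem' {a b} ha hb := by
    rw [Set.mem_ofPred_eq, isIntegralOverIdeal_iff] at *
    rw [map_add]
    exact ha.add hb
  zero_mem' := by
    rw [Set.mem_ofPred_eq, isIntegralOverIdeal_iff, map_zero]
    exact isIntegral_zero
  smul_mem' a r hr := by
    rw [Set.mem_ofPred_eq, isIntegralOverIdeal_iff] at *
    have h := (isIntegral_algebraMap (R := reesAlgebra I) (A := R[X])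
      (x := algebraMap R (reesAlgebra I) a)).mul hr
    have e : algebraMap (reesAlgebra I) R[X] (algebraMap R (reesAlgebra I) a) *
        (monomial 1 r : R[X]) = monomial 1 (a • r) := by
      change C a * monomial 1 r = _
      rw [C_mul_monomial, smul_eq_mul]
    rwa [e] at h

/-- `Ass(I)`, the set of associated primes of the `R`-module `R / I`. -/
def Ass {R : Type*} [CommRing R] (I : Ideal R) : Set (Ideal R) :=
  associatedPrimes R (R ⧸ I)

/-- The smallest integer `k₀ ≥ 1` with `Ass(I ^ k) = Ass(I ^ k₀)` for all `k ≥ k₀`.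
(If there were no such integer the value would be `0`, so a positive value of `astab I` is the
least element of the set.) -/
noncomputable def astab {R : Type*} [CommRing R] (I : Ideal R) : ℕ :=
  sInf {k₀ | 1 ≤ k₀ ∧ ∀ k, k₀ ≤ k → Ass (I ^ k) = Ass (I ^ k₀)}

/-- The smallest integer `k₀ ≥ 1` such that, for all `k ≥ k₀`, the integral closures of `I ^ k` and
of `I ^ k₀` have the same associated primes (with the same remark about the value `0`). -/
noncomputable def astabBar {R : Type*} [CommRing R] (I : Ideal R) : ℕ :=
  sInf {k₀ | 1 ≤ k₀ ∧ ∀ k, k₀ ≤ k →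
    Ass (idealIntegralClosure (I ^ k)) = Ass (idealIntegralClosure (I ^ k₀))}

/-- The ideal `(x ^ (2c+2), x y ^ (2c) z, y ^ (2c+2) z)` of `K[x, y, z]`. -/
noncomputable def exampleIdeal (K : Type*) [Field K] (c : ℕ) : Ideal (MvPolynomial (Fin 3) K) :=
  let x : MvPolynomial (Fin 3) K := MvPolynomial.X 0
  let y : MvPolynomial (Fin 3) K := MvPolynomial.X 1
  let z : MvPolynomial (Fin 3) K := MvPolynomial.X 2
  Ideal.span {x ^ (2 * c + 2), x * y ^ (2 * c) * z, y ^ (2 * c + 2) * z}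

end AssStability

/-! For `k ≥ 1`, `I ^ k` and its integral closure are monomial ideals with radical (x, y) ∩ (x, z).
Associated primes of a monomial ideal are generated by variables, so besides the two minimal primes
only (x, y, z) can occur, and it does exactly when there is a socle monomial: one outside the ideal
that every variable multiplies into it (`SupportedBy.Ass_eq`). Each index is therefore the threshold
on `k` for the existence of such a monomial, which is a question about exponent vectors.

For `I ^ k` the exponents dominate sums of `k` generator exponents, and integrality matters:
`powExponent_socle_iff` gives the threshold `c + 2`. For the integral closure they are the lattice
points of the `k`-fold Newton polyhedron, cut out by four linear inequalities: weights of monomials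
show that these are necessary (`IsIntegralOverIdeal.le_weight`), and clearing denominators in a
convex combination of the generators shows that they suffice (`NewtonExponent.powExponent_mul`). A
lattice point just below the compact facet gives a socle monomial as soon as `k ≥ 2`
(`newtonExponent_socle_iff`). -/

namespace AssStability

open MvPolynomial

/-! ### Associated primes of monomial ideals. -/

section MonomialIdeals

variable {σ K : Type*} [Field K]

/-- An ideal of a polynomial ring is monomial if it contains every monomial that occurs in one
of its elements. -/
def IsMonomialIdeal (J : Ideal (MvPolynomial σ K)) : Prop :=
  ∀ f ∈ J, ∀ m ∈ f.support, monomial m (1 : K) ∈ J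

theorem monomial_mem_of_le {J : Ideal (MvPolynomial σ K)} {m n : σ →₀ ℕ} (hmn : m ≤ n)
    (h : monomial m (1 : K) ∈ J) (a : K) : monomial n a ∈ J := by
  have : monomial n a = monomial (n - m) a * monomial m (1 : K) := by
    rw [monomial_mul, tsub_add_cancel_of_le hmn, mul_one]
  rw [this]
  exact J.mul_mem_left _ h

theorem mem_of_monomial_mem {J : Ideal (MvPolynomial σ K)} {f : MvPolynomial σ K}
    (h : ∀ m ∈ f.support, monomial m (1 : K) ∈ J) : f ∈ J := by
  rw [f.as_sum]
  exact J.sum_mem fun m hm => monomial_mem_of_le le_rfl (h m hm) _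

/-- Split a polynomial along a predicate on exponents. -/
theorem exists_add_support (f : MvPolynomial σ K) (p : (σ →₀ ℕ) → Prop) :
    ∃ g h : MvPolynomial σ K, f = g + h ∧ (∀ m ∈ g.support, m ∈ f.support ∧ p m) ∧
      ∀ m ∈ h.support, m ∈ f.support ∧ ¬ p m := by
  classical
  have key : ∀ s : Finset (σ →₀ ℕ), ∀ m ∈ (∑ n ∈ s, monomial n (f.coeff n)).support, m ∈ s := by
    intro s m hm
    by_contra hs
    rw [mem_support_iff, coeff_sum] at hm
    refine hm (Finset.sum_eq_zero fun n hn => ?_)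
    rw [coeff_monomial, if_neg]
    rintro rfl
    exact hs hn
  refine ⟨∑ n ∈ f.support.filter p, monomial n (f.coeff n),
    ∑ n ∈ f.support.filter (fun n => ¬ p n), monomial n (f.coeff n), ?_, ?_, ?_⟩
  · rw [Finset.sum_filter_add_sum_filter_not]
    exact f.as_sum
  · exact fun m hm => Finset.mem_filter.mp (key _ m hm)
  · exact fun m hm => Finset.mem_filter.mp (key _ m hm)

theorem mem_Ass_iff [Finite σ] {J P : Ideal (MvPolynomial σ K)} :
    P ∈ Ass J ↔ P.IsPrime ∧ ∃ f, ∀ g, g ∈ P ↔ g * f ∈ J := by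
  rw [Ass, AssociatedPrimes.mem_iff, isAssociatedPrime_iff]
  refine and_congr_right fun _ => ?_
  rw [Ideal.Quotient.mk_surjective.exists]
  refine exists_congr fun f => ?_
  rw [SetLike.ext_iff]
  refine forall_congr' fun g => ?_
  rw [Submodule.mem_colon_singleton, Submodule.mem_bot,
    ← Ideal.Quotient.eq_zero_iff_mem (I := J), map_mul]
  exact Iff.rfl

theorem exists_X_mem_of_monomial_mem {P : Ideal (MvPolynomial σ K)} (hP : P.IsPrime)
    {a : σ →₀ ℕ} (h : monomial a (1 : K) ∈ P) : ∃ i ∈ a.support, X i ∈ P := by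
  rw [monomial_eq, C_1, one_mul, Finsupp.prod, hP.prod_mem_iff] at h
  obtain ⟨i, hi, h⟩ := h
  exact ⟨i, hi, hP.mem_of_pow_mem _ h⟩

/-- Associated primes of a monomial ideal are generated by variables. -/
theorem eq_span_X_of_mem_Ass [Finite σ] {J P : Ideal (MvPolynomial σ K)} (hJ : IsMonomialIdeal J)
    (hP : P ∈ Ass J) : P = Ideal.span (X '' {i | X i ∈ P}) := by
  classical
  obtain ⟨hprime, f, hf⟩ := mem_Ass_iff.mp hP
  have hle : Ideal.span (X '' {i | X i ∈ P}) ≤ P := by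
    rw [Ideal.span_le]
    rintro _ ⟨i, hi, rfl⟩
    exact hi
  refine le_antisymm (fun g hg => ?_) hle
  by_contra hgs
  let _ : LinearOrder σ := IsWellOrder.linearOrder WellOrderingRel
  let o : MonomialOrder σ := MonomialOrder.lex
  obtain ⟨g₁, g₀, rfl, hg₁, hg₀⟩ := exists_add_support g fun m => ∃ i ∈ {i | X i ∈ P}, m i ≠ 0
  have hg₁s : g₁ ∈ Ideal.span (X '' {i | X i ∈ P}) :=
    mem_ideal_span_X_image.mpr fun m hm => (hg₁ m hm).2
  have hg₀P : g₀ ∈ P := (P.add_mem_iff_right (hle hg₁s)).mp hg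
  have hg₀0 : g₀ ≠ 0 := by
    rintro rfl
    exact hgs (by simpa using hg₁s)
  let U : (σ →₀ ℕ) → Prop := fun a => ∀ i, X i ∈ P → a i = 0
  have hg₀U : ∀ m ∈ g₀.support, U m := by
    intro m hm i hi
    by_contra h
    exact (hg₀ m hm).2 ⟨i, hi, h⟩
  -- `T` describes the saturation of `J` by the variables outside `P`. Terms of `f` in it should not
  -- matter, since those variables are nonzero modulo `P`.
  let T : (σ →₀ ℕ) → Prop := fun n => ∃ a, U a ∧ monomial (a + n) (1 : K) ∈ J
  obtain ⟨f₁, f₀, rfl, hf₁, hf₀⟩ := exists_add_support f T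
  have hT : ∀ a n, U a → T (a + n) → T n := by
    rintro a n ha ⟨b, hb, h⟩
    refine ⟨b + a, fun i hi => by simp [ha i hi, hb i hi], ?_⟩
    rwa [add_assoc]
  -- Otherwise one monomial in the variables outside `P` would multiply all of `f` into `J`, hence
  -- lie in the prime `P`.
  have hf₀0 : f₀ ≠ 0 := by
    rintro rfl
    choose! a haU haJ using fun n (hn : n ∈ f₁.support) => (hf₁ n hn).2
    have hle : ∀ n ∈ f₁.support, a n ≤ ∑ n ∈ f₁.support, a n :=
      fun n hn => Finset.single_le_sum (fun _ _ => zero_le) hn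
    have hA : monomial (∑ n ∈ f₁.support, a n) (1 : K) ∈ P := by
      rw [hf, add_zero]
      generalize ∑ n ∈ f₁.support, a n = A at hle
      rw [f₁.as_sum, Finset.mul_sum]
      refine J.sum_mem fun n hn => ?_
      rw [monomial_mul]
      exact monomial_mem_of_le (add_le_add_left (hle n hn) n) (haJ n hn) _
    obtain ⟨i, hi, hiP⟩ := exists_X_mem_of_monomial_mem hprime hA
    rw [Finsupp.mem_support_iff, Finsupp.finsetSum_apply] at hi
    exact hi (Finset.sum_eq_zero fun n hn => haU n hn i hiP)
  have hdg : U (o.degree g₀) := hg₀U _ (o.degree_mem_support hg₀0)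
  have hdf : ¬ T (o.degree f₀) := (hf₀ _ (o.degree_mem_support hf₀0)).2
  refine hdf (hT _ _ hdg ?_)
  have hmem := (hf g₀).mp hg₀P
  -- The product of the leading monomials either occurs in `g₀ * f₁`, whose terms all satisfy `T`,
  -- or survives in `g₀ * f ∈ J`. Both put the leading exponent of `f₀` in `T`.
  by_cases h1 : o.degree g₀ + o.degree f₀ ∈ (g₀ * f₁).support
  · obtain ⟨m, hm, n, hn, hmn⟩ := Finset.mem_add.mp (support_mul _ _ h1)
    obtain ⟨a, ha, haJ⟩ := (hf₁ n hn).2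
    rw [← hmn]
    exact ⟨a, ha, monomial_mem_of_le (by rw [add_left_comm]; exact le_add_self) haJ _⟩
  · refine ⟨0, fun _ _ => rfl, ?_⟩
    rw [zero_add]
    refine hJ _ hmem _ ?_
    rw [mem_support_iff, mul_add, coeff_add, notMem_support_iff.mp h1, zero_add,
      o.coeff_mul_of_degree_add]
    exact mul_ne_zero (o.leadingCoeff_ne_zero_iff.mpr hg₀0) (o.leadingCoeff_ne_zero_iff.mpr hf₀0)

/-- It is the kernel of the endomorphism killing the variables in `s`, which is the identity modulo
the ideal. -/
theorem isPrime_span_X_image (s : Set σ) :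
    (Ideal.span (X '' s : Set (MvPolynomial σ K))).IsPrime := by
  classical
  let φ : MvPolynomial σ K →ₐ[K] MvPolynomial σ K := aeval fun i => if i ∈ s then 0 else X i
  have h : Ideal.span (X '' s : Set (MvPolynomial σ K)) = RingHom.ker φ := by
    refine le_antisymm ?_ fun f hf => ?_
    · rw [Ideal.span_le]
      rintro _ ⟨i, hi, rfl⟩
      simp [φ, hi]
    · have e : (Ideal.Quotient.mkₐ K (Ideal.span (X '' s))).comp φ =
          Ideal.Quotient.mkₐ K (Ideal.span (X '' s : Set (MvPolynomial σ K))) := by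
        refine algHom_ext fun i => ?_
        by_cases hi : i ∈ s
        · have : (X i : MvPolynomial σ K) ∈ Ideal.span (X '' s : Set (MvPolynomial σ K)) :=
            Ideal.subset_span ⟨i, hi, rfl⟩
          simp [φ, hi, Ideal.Quotient.eq_zero_iff_mem.mpr this]
        · simp [φ, hi]
      have := DFunLike.congr_fun e f
      rw [AlgHom.comp_apply, RingHom.mem_ker.mp hf, map_zero] at this
      exact Ideal.Quotient.eq_zero_iff_mem.mp this.symm
  rw [h]
  exact RingHom.ker_isPrime _

/-- The ideal of all the variables is associated to a monomial ideal exactly when there is a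
socle monomial. -/
theorem idealOfVars_mem_Ass_iff [Finite σ] {J : Ideal (MvPolynomial σ K)}
    (hJ : IsMonomialIdeal J) :
    Ideal.span (X '' Set.univ) ∈ Ass J ↔ ∃ u, monomial u (1 : K) ∉ J ∧
      ∀ i, monomial (u + Finsupp.single i 1) (1 : K) ∈ J := by
  rw [mem_Ass_iff, and_iff_right (isPrime_span_X_image _)]
  constructor
  · rintro ⟨f, hf⟩
    have h1 : f ∉ J := by
      intro h
      have := (hf 1).mpr (by rwa [one_mul])
      exact (isPrime_span_X_image (K := K) (Set.univ : Set σ)).ne_top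
        ((Ideal.eq_top_iff_one _).mpr this)
    obtain ⟨u, hu, huJ⟩ : ∃ u ∈ f.support, monomial u (1 : K) ∉ J := by
      by_contra! h
      exact h1 (mem_of_monomial_mem h)
    refine ⟨u, huJ, fun i => hJ (X i * f) ((hf _).mp (Ideal.subset_span ⟨i, trivial, rfl⟩)) _ ?_⟩
    rw [mem_support_iff, add_comm, coeff_X_mul]
    exact mem_support_iff.mp hu
  · rintro ⟨u, hu, h⟩
    refine ⟨monomial u 1, fun g => ⟨fun hg => ?_, fun hg => ?_⟩⟩
    · have : Ideal.span (X '' Set.univ) ≤ J.colon {monomial u (1 : K)} := by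
        rw [Ideal.span_le]
        rintro _ ⟨i, -, rfl⟩
        rw [SetLike.mem_coe, Submodule.mem_colon_singleton, smul_eq_mul, mul_comm, X, monomial_mul,
          mul_one]
        exact h i
      simpa [Submodule.mem_colon_singleton] using this hg
    · by_contra hgs
      rw [mem_ideal_span_X_image] at hgs
      push Not at hgs
      obtain ⟨m, hm, hm0⟩ := hgs
      obtain rfl : m = 0 := Finsupp.ext fun i => hm0 i trivial
      refine hu (hJ _ hg u ?_)
      rw [mem_support_iff, coeff_mul_monomial', if_pos le_rfl, tsub_self, mul_one]
      exact mem_support_iff.mp hm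

theorem mem_Ass_of_mem_minimalPrimes [Finite σ] {J P : Ideal (MvPolynomial σ K)}
    (h : P ∈ J.minimalPrimes) : P ∈ Ass J := by
  refine Module.associatedPrimes.minimalPrimes_annihilator_subset_associatedPrimes _ _ ?_
  rwa [Ideal.annihilator_quotient]

end MonomialIdeals

end AssStability

namespace AssStability

open MvPolynomial

/-! ### Three variables: reduction to exponent vectors. -/

section ThreeVariables

variable {K : Type*} [Field K]

/-- The exponent vector `(p, q, r)`. -/
noncomputable def expVec (p q r : ℕ) : Fin 3 →₀ ℕ :=
  Finsupp.single 0 p + Finsupp.single 1 q + Finsupp.single 2 r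

@[simp] theorem expVec_zero (p q r : ℕ) : expVec p q r 0 = p := by simp [expVec]

@[simp] theorem expVec_one (p q r : ℕ) : expVec p q r 1 = q := by simp [expVec]

@[simp] theorem expVec_two (p q r : ℕ) : expVec p q r 2 = r := by simp [expVec]

theorem monomial_fin_three (m : Fin 3 →₀ ℕ) :
    monomial m (1 : K) = X 0 ^ m 0 * X 1 ^ m 1 * X 2 ^ m 2 := by
  rw [monomial_eq, C_1, one_mul, Finsupp.prod_fintype _ _ (fun _ => pow_zero _),
    Fin.prod_univ_three]

theorem le_fin_three {m n : Fin 3 →₀ ℕ} : m ≤ n ↔ m 0 ≤ n 0 ∧ m 1 ≤ n 1 ∧ m 2 ≤ n 2 := by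
  rw [Finsupp.le_def, Fin.forall_fin_succ, Fin.forall_fin_two]
  rfl

/-- The ideal `J` consists of the polynomials whose exponent vectors satisfy `Q`. -/
def SupportedBy (J : Ideal (MvPolynomial (Fin 3) K)) (Q : ℕ → ℕ → ℕ → Prop) : Prop :=
  ∀ f, f ∈ J ↔ ∀ m ∈ f.support, Q (m 0) (m 1) (m 2)

namespace SupportedBy

variable {J : Ideal (MvPolynomial (Fin 3) K)} {Q : ℕ → ℕ → ℕ → Prop}

theorem monomial_mem_iff (hJ : SupportedBy J Q) (m : Fin 3 →₀ ℕ) :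
    monomial m (1 : K) ∈ J ↔ Q (m 0) (m 1) (m 2) := by
  classical
  rw [hJ, support_monomial, if_neg one_ne_zero]
  simp

theorem isMonomialIdeal (hJ : SupportedBy J Q) : IsMonomialIdeal J :=
  fun f hf m hm => (hJ.monomial_mem_iff m).mpr ((hJ f).mp hf m hm)

theorem maximal_mem_Ass_iff (hJ : SupportedBy J Q) :
    Ideal.span (X '' Set.univ) ∈ Ass J ↔
      ∃ p q r, ¬ Q p q r ∧ Q (p + 1) q r ∧ Q p (q + 1) r ∧ Q p q (r + 1) := by
  rw [idealOfVars_mem_Ass_iff hJ.isMonomialIdeal]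
  simp only [hJ.monomial_mem_iff, Fin.forall_fin_succ, Finsupp.add_apply]
  constructor
  · rintro ⟨u, h⟩
    refine ⟨u 0, u 1, u 2, ?_⟩
    simpa using h
  · rintro ⟨p, q, r, h⟩
    refine ⟨expVec p q r, ?_⟩
    simpa using h

theorem le_span_X (hJ : SupportedBy J Q) {s : Set (Fin 3)}
    (h : ∀ p q r, Q p q r → ∃ i ∈ s, expVec p q r i ≠ 0) : J ≤ Ideal.span (X '' s) := by
  intro f hf
  rw [mem_ideal_span_X_image]
  intro m hm
  obtain ⟨i, hi, h⟩ := h _ _ _ ((hJ f).mp hf m hm)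
  refine ⟨i, hi, ?_⟩
  fin_cases i <;> simpa using h

theorem X_mem_of_le (hJ : SupportedBy J Q) {a b e : ℕ} (hx : Q a 0 0) (hyz : Q 0 b e)
    {P : Ideal (MvPolynomial (Fin 3) K)} (hP : P.IsPrime) (h : J ≤ P) :
    X 0 ∈ P ∧ (X 1 ∈ P ∨ X 2 ∈ P) := by
  have h1 := h ((hJ.monomial_mem_iff (expVec a 0 0)).mpr (by simpa using hx))
  have h2 := h ((hJ.monomial_mem_iff (expVec 0 b e)).mpr (by simpa using hyz))
  rw [monomial_fin_three] at h1 h2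
  simp only [expVec_zero, expVec_one, expVec_two, pow_zero, mul_one, one_mul] at h1 h2
  exact ⟨hP.mem_of_pow_mem _ h1,
    (hP.mem_or_mem h2).imp (hP.mem_of_pow_mem _) (hP.mem_of_pow_mem _)⟩

theorem X_mem_span_iff {s : Set (Fin 3)} {i : Fin 3} :
    (X i : MvPolynomial (Fin 3) K) ∈ Ideal.span (X '' s) ↔ i ∈ s := by
  classical
  rw [mem_ideal_span_X_image, support_X]
  simp [Finsupp.single_apply]

/-- This prime is minimal over `J`: a smaller prime over `J` contains x and one of y, z, and only
the variable with index `i` is available. -/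
theorem span_mem_Ass (hJ : SupportedBy J Q) {a b e : ℕ} (hx : Q a 0 0) (hyz : Q 0 b e)
    {i : Fin 3} (hi : i = 1 ∨ i = 2) (h : ∀ p q r, Q p q r → ∃ j ∈ ({0, i} : Set (Fin 3)),
      expVec p q r j ≠ 0) : Ideal.span (X '' {0, i}) ∈ Ass J := by
  refine mem_Ass_of_mem_minimalPrimes
    ⟨⟨isPrime_span_X_image _, hJ.le_span_X h⟩, fun P hP hle => ?_⟩
  obtain ⟨h0, h12⟩ := hJ.X_mem_of_le hx hyz hP.1 hP.2
  have key : X i ∈ P := by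
    rcases hi with rfl | rfl
    · refine h12.resolve_right fun h2 => ?_
      simpa using X_mem_span_iff.mp (hle h2)
    · refine h12.resolve_left fun h1 => ?_
      simpa using X_mem_span_iff.mp (hle h1)
  rw [Ideal.span_le]
  rintro _ ⟨j, rfl | rfl, rfl⟩
  · exact h0
  · exact key

/-- A proper ideal supported by exponents, with radical `(x, y) ∩ (x, z)`, has `(x, y)` and
`(x, z)` as associated primes, and at most the maximal ideal in addition. -/
theorem Ass_eq (hJ : SupportedBy J Q) {a b e : ℕ} (hx : Q a 0 0) (hyz : Q 0 b e)
    (hz : ∀ r, ¬ Q 0 0 r) (hy : ∀ q, ¬ Q 0 q 0) :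
    Ass J = {Ideal.span (X '' {0, 1}), Ideal.span (X '' {0, 2})} ∪
      {P | P = Ideal.span (X '' Set.univ) ∧
        ∃ p q r, ¬ Q p q r ∧ Q (p + 1) q r ∧ Q p (q + 1) r ∧ Q p q (r + 1)} := by
  ext P
  simp only [Set.mem_union, Set.mem_insert_iff, Set.mem_singleton_iff, Set.mem_ofPred_eq]
  constructor
  · intro hP
    have hJP : J ≤ P := by
      obtain ⟨-, f, hf⟩ := mem_Ass_iff.mp hP
      exact fun g hg => (hf g).mpr (J.mul_mem_right _ hg)
    have hspan := eq_span_X_of_mem_Ass hJ.isMonomialIdeal hP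
    obtain ⟨h0, h12⟩ := hJ.X_mem_of_le hx hyz hP.1 hJP
    by_cases h1 : X 1 ∈ P
    · by_cases h2 : X 2 ∈ P
      · have hs : {i | X i ∈ P} = Set.univ := by
          ext i
          fin_cases i <;> simp [h0, h1, h2]
        rw [hs] at hspan
        exact Or.inr ⟨hspan, hJ.maximal_mem_Ass_iff.mp (hspan ▸ hP)⟩
      · have hs : {i | X i ∈ P} = {0, 1} := by
          ext i
          fin_cases i <;> simp [h0, h1, h2]
        rw [hs] at hspan
        exact Or.inl (Or.inl hspan)
    · have h2 := h12.resolve_left h1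
      have hs : {i | X i ∈ P} = {0, 2} := by
        ext i
        fin_cases i <;> simp [h0, h1, h2]
      rw [hs] at hspan
      exact Or.inl (Or.inr hspan)
  · rintro ((rfl | rfl) | ⟨rfl, h⟩)
    · refine hJ.span_mem_Ass hx hyz (Or.inl rfl) fun p q r h => ?_
      by_contra! hc
      have h0 := hc 0 (by simp)
      have h1 := hc 1 (by simp)
      rw [expVec_zero] at h0
      rw [expVec_one] at h1
      subst h0 h1
      exact hz r h
    · refine hJ.span_mem_Ass hx hyz (Or.inr rfl) fun p q r h => ?_
      by_contra! hc
      have h0 := hc 0 (by simp)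
      have h2 := hc 2 (by simp)
      rw [expVec_zero] at h0
      rw [expVec_two] at h2
      subst h0 h2
      exact hy q h
    · exact hJ.maximal_mem_Ass_iff.mpr h

end SupportedBy

theorem maximal_notMem_pair : Ideal.span (X '' Set.univ) ∉
    ({Ideal.span (X '' {0, 1}), Ideal.span (X '' {0, 2})} :
      Set (Ideal (MvPolynomial (Fin 3) K))) := by
  have hm : ∀ i : Fin 3, (X i : MvPolynomial (Fin 3) K) ∈ Ideal.span (X '' Set.univ) :=
    fun i => SupportedBy.X_mem_span_iff.mpr trivial
  rintro (h | h)
  · have := hm 2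
    rw [h, SupportedBy.X_mem_span_iff] at this
    simp at this
  · have := hm 1
    rw [h, SupportedBy.X_mem_span_iff] at this
    simp at this

/-- The stability index of a sequence of sets that is constant except for one element, which
enters at the index `N`. -/
theorem sInf_stable_eq {α : Type*} {A : ℕ → Set α} {B : Set α} {m : α} {N : ℕ} (hN : 2 ≤ N)
    (hB : m ∉ B) (hA : ∀ k, 1 ≤ k → A k = B ∪ {P | P = m ∧ N ≤ k}) :
    sInf {k₀ | 1 ≤ k₀ ∧ ∀ k, k₀ ≤ k → A k = A k₀} = N := by
  have hmem : N ∈ {k₀ | 1 ≤ k₀ ∧ ∀ k, k₀ ≤ k → A k = A k₀} := by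
    refine ⟨by omega, fun k hk => ?_⟩
    rw [hA k (by omega), hA N (by omega)]
    simp [hk]
  refine le_antisymm (Nat.sInf_le hmem) (le_csInf ⟨N, hmem⟩ ?_)
  rintro k₀ ⟨h1, h⟩
  by_contra! hlt
  have hin : m ∈ A N := by
    rw [hA N (by omega)]
    exact Or.inr ⟨rfl, le_rfl⟩
  rw [h N hlt.le, hA k₀ h1] at hin
  rcases hin with hin | hin
  · exact hB hin
  · exact absurd hin.2 (by omega)

/-! ### Ordinary powers. -/

/-- The exponents `(p, q, r)` of the monomials in the `k`-th power of the ideal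
`(x ^ (2c+2), x y ^ (2c) z, y ^ (2c+2) z)`. -/
def PowExponent (c k p q r : ℕ) : Prop :=
  ∃ a b e, a + b + e = k ∧ (2 * c + 2) * a + b ≤ p ∧ 2 * c * b + (2 * c + 2) * e ≤ q ∧ b + e ≤ r

theorem pow_le_span_powExponent (c k : ℕ) : exampleIdeal K c ^ k ≤
    Ideal.span ((fun m => monomial m (1 : K)) '' {m | PowExponent c k (m 0) (m 1) (m 2)}) := by
  induction k with
  | zero =>
    rw [pow_zero, Ideal.one_eq_top, top_le_iff, Ideal.eq_top_iff_one]
    exact Ideal.subset_span ⟨0, ⟨0, 0, 0, by simp⟩, rfl⟩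
  | succ k ih =>
    rw [pow_succ]
    refine (Ideal.mul_mono_left ih).trans ?_
    rw [exampleIdeal, Ideal.span_mul_span', Ideal.span_le]
    rintro _ ⟨_, ⟨m, ⟨a, b, e, hk, hp, hq, hr⟩, rfl⟩, g, hg, rfl⟩
    rcases hg with rfl | rfl | rfl
    · refine Ideal.subset_span ⟨m + expVec (2 * c + 2) 0 0, ⟨a + 1, b, e, ?_⟩, ?_⟩
      · simp only [Finsupp.add_apply, expVec_zero, expVec_one, expVec_two]
        refine ⟨by omega, by linarith, by linarith, by linarith⟩
      · simp only [monomial_fin_three, Finsupp.add_apply, expVec_zero, expVec_one, expVec_two]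
        ring
    · refine Ideal.subset_span ⟨m + expVec 1 (2 * c) 1, ⟨a, b + 1, e, ?_⟩, ?_⟩
      · simp only [Finsupp.add_apply, expVec_zero, expVec_one, expVec_two]
        refine ⟨by omega, by linarith, by linarith, by linarith⟩
      · simp only [monomial_fin_three, Finsupp.add_apply, expVec_zero, expVec_one, expVec_two]
        ring
    · refine Ideal.subset_span ⟨m + expVec 0 (2 * c + 2) 1, ⟨a, b, e + 1, ?_⟩, ?_⟩
      · simp only [Finsupp.add_apply, expVec_zero, expVec_one, expVec_two]
        refine ⟨by omega, by linarith, by linarith, by linarith⟩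
      · simp only [monomial_fin_three, Finsupp.add_apply, expVec_zero, expVec_one, expVec_two]
        ring

theorem monomial_mem_pow {c k : ℕ} {m : Fin 3 →₀ ℕ} (h : PowExponent c k (m 0) (m 1) (m 2)) :
    monomial m (1 : K) ∈ exampleIdeal K c ^ k := by
  obtain ⟨a, b, e, rfl, hp, hq, hr⟩ := h
  obtain ⟨p, hp⟩ := Nat.exists_eq_add_of_le hp
  obtain ⟨q, hq⟩ := Nat.exists_eq_add_of_le hq
  obtain ⟨r, hr⟩ := Nat.exists_eq_add_of_le hr
  have e1 : monomial m (1 : K) = X 0 ^ p * X 1 ^ q * X 2 ^ r *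
      ((X 0 ^ (2 * c + 2)) ^ a * (X 0 * X 1 ^ (2 * c) * X 2) ^ b *
        (X 1 ^ (2 * c + 2) * X 2) ^ e) := by
    rw [monomial_fin_three, hp, hq, hr]
    ring
  rw [e1, pow_add, pow_add]
  refine Ideal.mul_mem_left _ _ (Ideal.mul_mem_mul (Ideal.mul_mem_mul ?_ ?_) ?_) <;>
    refine Ideal.pow_mem_pow (Ideal.subset_span ?_) _ <;> simp

theorem supportedBy_pow (c k : ℕ) : SupportedBy (exampleIdeal K c ^ k) (PowExponent c k) := by
  intro f
  refine ⟨fun hf m hm => ?_, fun h => mem_of_monomial_mem fun m hm => monomial_mem_pow (h m hm)⟩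
  obtain ⟨n, ⟨a, b, e, hk, hp, hq, hr⟩, hle⟩ :=
    mem_ideal_span_monomial_image.mp (pow_le_span_powExponent c k hf) m hm
  rw [le_fin_three] at hle
  exact ⟨a, b, e, hk, hp.trans hle.1, hq.trans hle.2.1, hr.trans hle.2.2⟩

theorem powExponent_socle_iff {c k : ℕ} :
    (∃ p q r, ¬ PowExponent c k p q r ∧ PowExponent c k (p + 1) q r ∧
      PowExponent c k p (q + 1) r ∧ PowExponent c k p q (r + 1)) ↔ c + 2 ≤ k := by
  constructor
  · rintro ⟨p, q, r, hn, -, ⟨a₁, b₁, e₁, hk₁, hp₁, -, hr₁⟩, a₂, b₂, e₂, hk₂, hp₂, hq₂, hr₂⟩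
    have hr : b₂ + e₂ = r + 1 := by
      refine le_antisymm hr₂ ?_
      by_contra! hlt
      exact hn ⟨a₂, b₂, e₂, hk₂, hp₂, hq₂, by omega⟩
    by_contra! hlt
    -- The y-step uses at most `r` generators divisible by z, so x allows `k - r` pure powers. The
    -- z-step uses exactly `r + 1`, so `r ≤ c` and `q ≥ 2c(r + 1) ≥ (2c + 2)r`.
    refine hn ⟨k - r, 0, r, by omega, ?_, ?_, by omega⟩
    · have : (2 * c + 2) * (k - r) ≤ (2 * c + 2) * a₁ := Nat.mul_le_mul_left _ (by omega)
      omega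
    · have h1 : 2 * c * (b₂ + e₂) = 2 * c * (r + 1) := by rw [hr]
      nlinarith
  · intro hk
    obtain ⟨j, rfl⟩ := Nat.exists_eq_add_of_le hk
    -- The y-exponent is `(2c + 2)(c + 1) - 1`. The bounds on z and x force the decomposition `(j +
    -- 1, 0, c + 1)`, which misses by a single y.
    refine ⟨(2 * c + 2) * (j + 1), 2 * c ^ 2 + 4 * c + 1, c + 1, ?_,
      ⟨j + 1, 1, c, by ring, by ring_nf; rfl, by nlinarith, by omega⟩,
      ⟨j + 1, 0, c + 1, by ring, by ring_nf; rfl, by nlinarith, by omega⟩,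
      ⟨j, c + 2, 0, by ring, by nlinarith, by nlinarith, by omega⟩⟩
    rintro ⟨a, b, e, hs, hp, hq, hr⟩
    obtain ⟨i, rfl⟩ : ∃ i, a = j + 1 + i := Nat.exists_eq_add_of_le (by omega)
    have hi : i = 0 ∧ b = 0 := by
      have : (2 * c + 2) * (j + 1 + i) = (2 * c + 2) * (j + 1) + 2 * (c * i) + 2 * i := by ring
      omega
    obtain ⟨rfl, rfl⟩ := hi
    obtain rfl : e = c + 1 := by omega
    nlinarith

theorem astab_exampleIdeal (K : Type*) [Field K] (c : ℕ) :
    astab (exampleIdeal K c) = c + 2 := by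
  refine sInf_stable_eq (by omega) maximal_notMem_pair fun k hk => ?_
  rw [(supportedBy_pow c k).Ass_eq (a := (2 * c + 2) * k) (b := (2 * c + 2) * k) (e := k)
    ⟨k, 0, 0, by simp⟩ ⟨0, 0, k, by simp⟩ ?_ ?_]
  · simp only [powExponent_socle_iff]
  · rintro r ⟨a, b, e, hk', hp, hq, -⟩
    have ha : (2 * c + 2) * a = 0 := by omega
    have he : (2 * c + 2) * e = 0 := by omega
    simp at ha he
    omega
  · rintro q ⟨a, b, e, hk', hp, -, hr⟩
    have ha : (2 * c + 2) * a = 0 := by omega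
    simp at ha
    omega

end ThreeVariables

end AssStability

namespace AssStability

open MvPolynomial

/-! ### Weights and integral dependence. -/

section Weights

variable {σ K : Type*} [Field K]

/-- The homomorphism `X i ↦ X i * T ^ w i` that records the weight of monomials. -/
noncomputable def weightHom (K : Type*) [Field K] (w : σ → ℕ) :
    MvPolynomial σ K →ₐ[K] Polynomial (MvPolynomial σ K) :=
  aeval fun i => Polynomial.C (X i) * Polynomial.X ^ w i

theorem weightHom_monomial (w : σ → ℕ) (m : σ →₀ ℕ) (a : K) :
    weightHom K w (monomial m a) = Polynomial.monomial (Finsupp.weight w m) (monomial m a) := by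
  have hT : ∏ i ∈ m.support, (Polynomial.X ^ w i : Polynomial (MvPolynomial σ K)) ^ m i =
      Polynomial.X ^ Finsupp.weight w m := by
    simp only [← pow_mul]
    rw [Finset.prod_pow_eq_pow_sum, Finsupp.weight_apply, Finsupp.sum]
    simp only [smul_eq_mul, mul_comm]
  have hC : (Polynomial.C (monomial m a) : Polynomial (MvPolynomial σ K)) =
      Polynomial.C (C a) * ∏ i ∈ m.support, Polynomial.C (X i) ^ m i := by
    rw [monomial_eq, map_mul, Finsupp.prod, map_prod]
    simp only [map_pow]
  rw [weightHom, aeval_monomial, ← Polynomial.C_mul_X_pow_eq_monomial, hC, Finsupp.prod]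
  simp only [mul_pow]
  rw [Finset.prod_mul_distrib, hT, mul_assoc]
  rfl

/-- Keeping `X i` beside the power of the new variable prevents distinct monomials of equal weight
from cancelling. -/
theorem coeff_coeff_weightHom (w : σ → ℕ) (f : MvPolynomial σ K) (m : σ →₀ ℕ) :
    ((weightHom K w f).coeff (Finsupp.weight w m)).coeff m = f.coeff m := by
  classical
  induction f using MvPolynomial.induction_on' with
  | monomial n a =>
    rw [weightHom_monomial, Polynomial.coeff_monomial]
    by_cases h : n = m
    · rw [h, if_pos rfl]
    · split_ifs
      · rfl
      · rw [coeff_zero, coeff_monomial, if_neg h]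
  | add p q hp hq => rw [map_add, Polynomial.coeff_add, coeff_add, hp, hq, coeff_add]

theorem X_pow_dvd_weightHom_iff (w : σ → ℕ) (f : MvPolynomial σ K) (h : ℕ) :
    Polynomial.X ^ h ∣ weightHom K w f ↔ ∀ m ∈ f.support, h ≤ Finsupp.weight w m := by
  constructor
  · intro hd m hm
    by_contra! hlt
    rw [Polynomial.X_pow_dvd_iff] at hd
    rw [mem_support_iff, ← coeff_coeff_weightHom w, hd _ hlt, coeff_zero] at hm
    exact hm rfl
  · intro hs
    rw [f.as_sum, map_sum]
    refine Finset.dvd_sum fun m hm => ?_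
    rw [weightHom_monomial, ← Polynomial.C_mul_X_pow_eq_monomial]
    exact Dvd.dvd.mul_left (pow_dvd_pow _ (hs m hm)) _

/-- Powers of prime elements generate integrally closed ideals. -/
theorem pow_dvd_of_pow_eq_neg_sum {A : Type*} [CommRing A] [IsDomain A] [WfDvdMonoid A] {t F : A}
    (ht : Prime t) {h n : ℕ} {a : ℕ → A} (ha : ∀ i, t ^ (h * (n - i)) ∣ a i)
    (hF : F ^ n = -∑ i ∈ Finset.range n, a i * F ^ i) : t ^ h ∣ F := by
  by_cases hz : F = 0
  · rw [hz]
    exact dvd_zero _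
  obtain ⟨e, g, hg, rfl⟩ := WfDvdMonoid.max_power_factor hz ht.irreducible
  by_cases hhe : h ≤ e
  · exact Dvd.dvd.mul_right (pow_dvd_pow _ hhe) _
  exfalso
  -- With `e < h`, each term is divisible by `t ^ (h(n - i) + ei)`, and this exponent exceeds `en`
  -- because `i < n`.
  have hdvd : t ^ (e * n + 1) ∣ (t ^ e * g) ^ n := by
    rw [hF, dvd_neg]
    refine Finset.dvd_sum fun i hi => ?_
    obtain ⟨j, rfl⟩ := Nat.exists_eq_add_of_lt (Finset.mem_range.mp hi)
    have h1 := ha i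
    have h2 : t ^ (e * i) ∣ (t ^ e * g) ^ i := by
      rw [mul_pow, pow_mul]
      exact dvd_mul_right _ _
    have h3 := mul_dvd_mul h1 h2
    rw [← pow_add] at h3
    refine (pow_dvd_pow _ ?_).trans h3
    obtain ⟨l, rfl⟩ := Nat.exists_eq_add_of_lt (not_le.mp hhe)
    rw [show i + j + 1 - i = j + 1 by omega]
    nlinarith [Nat.zero_le (l * (j + 1))]
  rw [mul_pow, ← pow_mul, pow_succ, mul_dvd_mul_iff_left (pow_ne_zero _ ht.ne_zero)] at hdvd
  exact hg (ht.dvd_of_dvd_pow hdvd)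

/-- A lower bound for the weights of the monomials of an ideal holds for its integral closure. -/
theorem IsIntegralOverIdeal.le_weight {w : σ → ℕ} {h : ℕ} {J : Ideal (MvPolynomial σ K)}
    (hJ : ∀ f ∈ J, ∀ m ∈ f.support, h ≤ Finsupp.weight w m) {f : MvPolynomial σ K}
    (hf : IsIntegralOverIdeal J f) : ∀ m ∈ f.support, h ≤ Finsupp.weight w m := by
  obtain ⟨p, hp, h0, hc⟩ := hf
  rw [← X_pow_dvd_weightHom_iff]
  refine pow_dvd_of_pow_eq_neg_sum Polynomial.prime_X (n := p.natDegree)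
    (a := fun i => weightHom K w (p.coeff i)) (fun i => ?_) ?_
  · have hle : J ≤ (Ideal.span {Polynomial.X ^ h}).comap (weightHom K w) := by
      intro b hb
      rw [Ideal.mem_comap, Ideal.mem_span_singleton, X_pow_dvd_weightHom_iff]
      exact hJ b hb
    have := Ideal.le_comap_pow (weightHom K w) _ (Ideal.pow_right_mono hle _ (hc i))
    rwa [Ideal.mem_comap, Ideal.span_singleton_pow, Ideal.mem_span_singleton, ← pow_mul] at this
  · rw [Polynomial.eval_eq_sum_range, Finset.sum_range_succ, hp.coeff_natDegree, one_mul] at h0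
    have := congrArg (weightHom K w) h0
    simp only [map_add, map_sum, map_mul, map_pow, map_zero] at this
    exact eq_neg_of_add_eq_zero_right this

end Weights

theorem isIntegralOverIdeal_of_pow_mem {R : Type*} [CommRing R] [Nontrivial R] {J : Ideal R} {r : R}
    {n : ℕ} (hn : n ≠ 0) (h : r ^ n ∈ J ^ n) : IsIntegralOverIdeal J r := by
  refine ⟨Polynomial.X ^ n - Polynomial.C (r ^ n), Polynomial.monic_X_pow_sub_C _ hn, by simp,
    fun i => ?_⟩
  rw [Polynomial.natDegree_X_pow_sub_C, Polynomial.coeff_sub, Polynomial.coeff_X_pow,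
    Polynomial.coeff_C]
  refine Ideal.sub_mem _ ?_ ?_
  · split_ifs with hi
    · simp [hi]
    · exact zero_mem _
  · split_ifs with hi
    · simpa [hi] using h
    · exact zero_mem _

/-! ### Integral closures and the Newton polyhedron. -/

section ThreeVariables

variable {K : Type*} [Field K]

/-- The exponents `(p, q, r)` in the `k`-fold Newton polyhedron of the ideal
`(x ^ (2c+2), x y ^ (2c) z, y ^ (2c+2) z)`. -/
def NewtonExponent (c k p q r : ℕ) : Prop :=
  (2 * c + 2) * k ≤ p + (2 * c + 2) * r ∧
  (2 * c + 2) * (2 * c) * k ≤ 2 * c * p + (2 * c + 1) * q ∧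
  (2 * c + 2) * k ≤ 2 * p + q ∧
  2 * (2 * c + 2) * k ≤ 2 * p + q + (2 * c + 2) * r

/-- Each inequality holds at the three generators; the fourth is an equality at all of them, so it
defines the compact facet. -/
theorem PowExponent.newtonExponent {c k p q r : ℕ} (h : PowExponent c k p q r) :
    NewtonExponent c k p q r := by
  obtain ⟨a, b, e, rfl, hp, hq, hr⟩ := h
  have hr' := Nat.mul_le_mul_left (2 * c + 2) hr
  refine ⟨?_, ?_, ?_, ?_⟩
  · nlinarith
  · have h1 := Nat.mul_le_mul_left (2 * c) hp
    have h2 := Nat.mul_le_mul_left (2 * c + 1) hq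
    nlinarith [Nat.zero_le (c * e), Nat.zero_le (c * c * e)]
  · nlinarith
  · nlinarith

/-- An exponent in the Newton polyhedron has a multiple in the exponent set of a power. -/
theorem NewtonExponent.powExponent_mul {c k p q r : ℕ} (h : NewtonExponent c k p q r) :
    PowExponent c (k * (2 * (2 * c + 2))) (2 * (2 * c + 2) * p) (2 * (2 * c + 2) * q)
      (2 * (2 * c + 2) * r) := by
  obtain ⟨h1, h2, h3, h4⟩ := h
  -- Fourier–Motzkin elimination for real multiplicities α, β, ε of the generators, with sum `k`.
  -- Here `s = (2c + 2)(β + ε)`, taken as the maximum of its lower bounds `D - p`, `2D - (2p + q)`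
  -- and 0 (by truncation), where `D = (2c + 2)k`.
  obtain ⟨s, hs1, hs2, hs3, hs4, hs5⟩ : ∃ s, (2 * c + 2) * k ≤ p + s ∧
      2 * ((2 * c + 2) * k) ≤ 2 * p + q + s ∧ s ≤ (2 * c + 2) * r ∧ s ≤ (2 * c + 2) * k ∧
      2 * c * s ≤ (2 * c + 2) * q := by
    have h4' : 2 * ((2 * c + 2) * k) ≤ 2 * p + q + (2 * c + 2) * r := by linarith
    have h2' : 2 * c * ((2 * c + 2) * k) ≤ 2 * c * p + (2 * c + 1) * q := by linarith
    generalize (2 * c + 2) * k = D at *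
    generalize (2 * c + 2) * r = E at *
    rcases le_total (D - p) (2 * D - (2 * p + q)) with h | h
    · refine ⟨2 * D - (2 * p + q), by omega, by omega, by omega, by omega, ?_⟩
      rcases le_total (2 * D) (2 * p + q) with h' | h'
      · simp [Nat.sub_eq_zero_of_le h']
      · obtain ⟨s, hs⟩ := Nat.exists_eq_add_of_le h'
        rw [hs, Nat.add_sub_cancel_left]
        nlinarith
    · refine ⟨D - p, by omega, by omega, by omega, by omega, ?_⟩
      rcases le_total D p with h' | h'
      · simp [Nat.sub_eq_zero_of_le h']
      · obtain ⟨s, rfl⟩ := Nat.exists_eq_add_of_le h'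
        rw [Nat.add_sub_cancel_left]
        nlinarith
  -- `b = 2β`: the y-bound reads `s - 2β ≤ q`, so the least choice is `s - q`, truncated at 0.
  obtain ⟨b, hb1, hb2, hb3⟩ : ∃ b, s ≤ q + b ∧ 2 * ((2 * c + 2) * k) + b ≤ 2 * p + 2 * s ∧
      (2 * c + 2) * b ≤ 2 * s := by
    refine ⟨s - q, by omega, by omega, ?_⟩
    rcases le_total s q with h' | h'
    · simp [Nat.sub_eq_zero_of_le h']
    · obtain ⟨b, rfl⟩ := Nat.exists_eq_add_of_le h'
      rw [Nat.add_sub_cancel_left]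
      nlinarith
  obtain ⟨a, ha⟩ := Nat.exists_eq_add_of_le hs4
  obtain ⟨e, he⟩ := Nat.exists_eq_add_of_le hb3
  refine ⟨2 * a, (2 * c + 2) * b, e, by nlinarith, ?_, ?_, by nlinarith⟩
  · have : 2 * a + b ≤ 2 * p := by omega
    calc (2 * c + 2) * (2 * a) + (2 * c + 2) * b = (2 * c + 2) * (2 * a + b) := by ring
      _ ≤ (2 * c + 2) * (2 * p) := Nat.mul_le_mul_left _ this
      _ = _ := by ring
  · calc 2 * c * ((2 * c + 2) * b) + (2 * c + 2) * e = (2 * c + 2) * (2 * c * b + e) := by ring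
      _ ≤ (2 * c + 2) * (2 * q) := Nat.mul_le_mul_left _ (by nlinarith)
      _ = _ := by ring

theorem weight_fin_three (w : Fin 3 → ℕ) (m : Fin 3 →₀ ℕ) :
    Finsupp.weight w m = w 0 * m 0 + w 1 * m 1 + w 2 * m 2 := by
  rw [Finsupp.weight_apply, Finsupp.sum_fintype _ _ (by simp), Fin.sum_univ_three]
  simp [mul_comm]

theorem supportedBy_idealIntegralClosure_pow (c k : ℕ) :
    SupportedBy (idealIntegralClosure (exampleIdeal K c ^ k)) (NewtonExponent c k) := by
  intro f
  constructor
  · intro hf m hm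
    have key : ∀ (w : Fin 3 → ℕ) (h : ℕ), (∀ p q r, NewtonExponent c k p q r →
        h ≤ w 0 * p + w 1 * q + w 2 * r) → h ≤ w 0 * m 0 + w 1 * m 1 + w 2 * m 2 := by
      intro w h hw
      rw [← weight_fin_three]
      refine IsIntegralOverIdeal.le_weight (J := exampleIdeal K c ^ k) ?_ hf m hm
      intro g hg n hn
      rw [weight_fin_three]
      exact hw _ _ _ ((supportedBy_pow c k g).mp hg n hn).newtonExponent
    -- The weight vectors are the coefficient vectors of the four inequalities.
    refine ⟨?_, ?_, ?_, ?_⟩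
    · simpa using key ![1, 0, 2 * c + 2] _ fun p q r h => by simpa using h.1
    · simpa using key ![2 * c, 2 * c + 1, 0] ((2 * c + 2) * (2 * c) * k)
        fun p q r h => by simpa using h.2.1
    · simpa using key ![2, 1, 0] _ fun p q r h => by simpa using h.2.2.1
    · simpa using key ![2, 1, 2 * c + 2] _ fun p q r h => by simpa using h.2.2.2
  · intro h
    refine mem_of_monomial_mem fun m hm => ?_
    refine isIntegralOverIdeal_of_pow_mem (n := 2 * (2 * c + 2)) (by omega) ?_
    rw [← pow_mul, monomial_pow, one_pow]
    refine monomial_mem_pow ?_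
    simpa using (h m hm).powExponent_mul

theorem newtonExponent_socle_iff {c k : ℕ} (hk : 1 ≤ k) :
    (∃ p q r, ¬ NewtonExponent c k p q r ∧ NewtonExponent c k (p + 1) q r ∧
      NewtonExponent c k p (q + 1) r ∧ NewtonExponent c k p q (r + 1)) ↔ 2 ≤ k := by
  constructor
  · rintro ⟨p, q, r, hn, -, h2, h3⟩
    by_contra! hlt
    obtain rfl : k = 1 := by omega
    refine hn ?_
    -- For `r = 0` the first inequality gives `p ≥ 2c + 2`, which implies the rest. For positive
    -- exponent of z, the first is automatic, the second and third do not involve z, and the fourth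
    -- follows from the third.
    rcases r with _ | r
    · have hp : 2 * c + 2 ≤ p := by simpa using h2.1
      refine ⟨by omega, ?_, by omega, by omega⟩
      have := Nat.mul_le_mul_left (2 * c) hp
      nlinarith [Nat.zero_le ((2 * c + 1) * q)]
    · refine ⟨by nlinarith, h3.2.1, h3.2.2.1, ?_⟩
      have := h3.2.2.1
      nlinarith
  · intro hk2
    obtain ⟨j, rfl⟩ := Nat.exists_eq_add_of_le hk2
    -- This point violates only the fourth inequality, by exactly 1.
    refine ⟨(2 * c + 2) * (j + 1), 2 * c + 1, 1, ?_, ⟨?_, ?_, ?_, ?_⟩, ⟨?_, ?_, ?_, ?_⟩,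
      ⟨?_, ?_, ?_, ?_⟩⟩
    · rintro ⟨-, -, -, h⟩
      nlinarith
    all_goals nlinarith [Nat.zero_le (c * j)]

theorem astabBar_exampleIdeal (K : Type*) [Field K] (c : ℕ) :
    astabBar (exampleIdeal K c) = 2 := by
  refine sInf_stable_eq le_rfl maximal_notMem_pair fun k hk => ?_
  rw [(supportedBy_idealIntegralClosure_pow c k).Ass_eq (a := (2 * c + 2) * k)
    (b := (2 * c + 2) * k) (e := k)
    (PowExponent.newtonExponent ⟨k, 0, 0, by simp⟩)
    (PowExponent.newtonExponent ⟨0, 0, k, by simp⟩) ?_ ?_]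
  · simp only [newtonExponent_socle_iff hk]
  · rintro r ⟨-, -, h, -⟩
    nlinarith
  · rintro q ⟨h, -, -, -⟩
    nlinarith

end ThreeVariables

end AssStability

theorem theorem1p4 (K : Type*) [Field K] (c : ℕ) (hc : 0 < c) :
    AssStability.astab (AssStability.exampleIdeal K c) = c + 2 ∧
    AssStability.astabBar (AssStability.exampleIdeal K c) = 2 ∧
    (AssStability.astab (AssStability.exampleIdeal K c) : ℤ) -
      (AssStability.astabBar (AssStability.exampleIdeal K c) : ℤ) = (c : ℤ) := by
  rw [AssStability.astab_exampleIdeal, AssStability.astabBar_exampleIdeal]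
  refine ⟨rfl, rfl, ?_⟩
  push_cast
  ring
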